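/- Let $\mathcal H$ be a complex Hilbert space, let $\mathcal M$ be a von Neumann algebra acting on $\mathcal H$ (a $*$-subalgebra of $\mathcal B(\mathcal H)$ that contains the identity $I$ and is closed in the weak operator topology, equivalently, equal to its double commutant), and let $A\in\mathcal M$ be positive. For $T\in\mathcal M$ put \[\|T\|_A:=\sup\Big\{\sqrt{f(T^*AT)} : f \text{ a positive linear functional on } \mathcal M \text{ with } f(A)=1\Big\}\in[0,\infty]\] (with $\sup\emptyset=0$), and let $\mathcal M^A:=\{T\in\mathcal M:\|T\|_A<\infty\}$. An element $T\in\mathcal M^A$ is called $A$-invertible in $\mathcal M^A$ if there is $S\in\mathcal M^A$ with $ATS=AST=A$, and the $A$-spectrum of $T\in\mathcal M^A$ is \[\sigma_A(T):=\{\lambda\in\mathbb C:\lambda I-T\text{ is not } A\text{-invertible in }\mathcal M^A\}.\] Let $n\ge 0$ be an integer. If $\sigma_A(T)$ has at most $n$ points for every $T\in\mathcal M^A$, then the complex vector space $A\mathcal M A=\{AXA:X\in\mathcal M\}$ is finite-dimensional and $\dim A\mathcal M A\le n^2$. -/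

import Mathlib

open scoped ComplexOrder

noncomputable section

namespace ASpectrum

variable {H : Type*} [NormedAddCommGroup H] [InnerProductSpace ℂ H] [CompleteSpace H]

/-- The set of positive (bounded) linear functionals `f` on the von Neumann algebra `M` with
`f A = 1`. Positivity means that `f T` is a nonnegative real number for every `T` in `M` that is
a positive operator. -/
def normalizedFunctionals (M : VonNeumannAlgebra H) (A : M.toStarSubalgebra) :
    Set (M.toStarSubalgebra →L[ℂ] ℂ) :=
  {f | (∀ T : M.toStarSubalgebra, (T : H →L[ℂ] H).IsPositive → 0 ≤ f T) ∧ f A = 1}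

/-- `‖T‖_A`, the supremum of `√(f (T⋆ A T))` over all positive functionals `f` on `M` with
`f A = 1`, with values in `[0, ∞]`. -/
def aNorm (M : VonNeumannAlgebra H) (A T : M.toStarSubalgebra) : ENNReal :=
  ⨆ f ∈ normalizedFunctionals M A, ENNReal.ofReal (Real.sqrt (f (star T * A * T)).re)

/-- `M^A`, the set of all `T` in `M` with `‖T‖_A < ∞`. -/
def aBounded (M : VonNeumannAlgebra H) (A : M.toStarSubalgebra) : Set M.toStarSubalgebra :=
  {T | aNorm M A T < ⊤}

/-- `T` is `A`-invertible in `M^A`: there is `S` in `M^A` with `A T S = A S T = A`. -/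
def IsAInvertible (M : VonNeumannAlgebra H) (A T : M.toStarSubalgebra) : Prop :=
  ∃ S ∈ aBounded M A, A * T * S = A ∧ A * S * T = A

/-- The `A`-spectrum of `T`: all complex `z` such that `z I - T` is not `A`-invertible
in `M^A`. -/
def aSpectrum (M : VonNeumannAlgebra H) (A T : M.toStarSubalgebra) : Set ℂ :=
  {z | ¬ IsAInvertible M A (z • (1 : M.toStarSubalgebra) - T)}

/-- The linear subspace `A M A = {A X A : X ∈ M}` of `M`. -/
def corner (M : VonNeumannAlgebra H) (A : M.toStarSubalgebra) :
    Submodule ℂ M.toStarSubalgebra :=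
  LinearMap.range (LinearMap.mulLeftRight ℂ (A, A))

end ASpectrum

end

/-! Dropping the boundedness of the inverse only shrinks the spectrum, so the bound `n` passes to
`algSpectrum`. Nonzero points of `spectrum ℂ A` lie in it, so `A` has finite spectrum, hence a
support projection `p ≤ c • A` with `B * A = p`. Then every `T = T * p` is `A`-bounded and has
finite spectrum. If `p` splits into `m` nonzero orthogonal projections `e i`, then `∑ i • e i` has
`m` points in its `A`-spectrum, so `m ≤ n`. In a splitting that cannot be refined each corner `e i R
e i` is scalar, each `e i R e j` has dimension at most one, and `A R A ⊆ p R p` has dimension at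
most `m ^ 2`. -/

namespace ASpectrum

/-! ### Ordinary spectrum against `A`-spectrum -/

section Algebra

variable {R : Type*} [Ring R] [Algebra ℂ R]

/-- The purely algebraic `A`-spectrum: the inverse is not required to be `A`-bounded. -/
def algSpectrum (A T : R) : Set ℂ :=
  {z | ¬ ∃ S, A * (z • (1 : R) - T) * S = A ∧ A * S * (z • (1 : R) - T) = A}

/-- Multiplying the `A`-inverse identities by `b` on the left gives `(z - a) a S = a = a S (z - a)`,
so `z⁻¹ (1 + a S)` inverts `z - a`. -/
theorem mem_algSpectrum_of_mem_spectrum {A a b : R} (hab : a = b * A) {z : ℂ} (hz : z ≠ 0)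
    (hza : z ∈ spectrum ℂ a) : z ∈ algSpectrum A a := by
  rintro ⟨S, h1, h2⟩
  have h1' : z • (a * S) - a * (a * S) = a := by
    have := congrArg (b * ·) h1
    simpa only [← mul_assoc, ← hab, mul_sub, sub_mul, mul_smul_comm, smul_mul_assoc, mul_one]
      using this
  have h2' : z • (a * S) - a * S * a = a := by
    have := congrArg (b * ·) h2
    simpa only [← mul_assoc, ← hab, mul_sub, mul_smul_comm, mul_one] using this
  rw [spectrum.mem_iff, Algebra.algebraMap_eq_smul_one] at hza
  refine hza ⟨⟨z • 1 - a, z⁻¹ • (1 + a * S), ?_, ?_⟩, rfl⟩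
  · rw [mul_smul_comm, mul_add, mul_one, sub_mul, smul_mul_assoc, one_mul, h1', sub_add_cancel,
      smul_smul, inv_mul_cancel₀ hz, one_smul]
  · rw [smul_mul_assoc, add_mul, one_mul, mul_sub, mul_smul_comm, mul_one, h2', sub_add_cancel,
      smul_smul, inv_mul_cancel₀ hz, one_smul]

theorem spectrum_finite_of_algSpectrum_encard_le {A a b : R} (hab : a = b * A) {n : ℕ}
    (h : (algSpectrum A a).encard ≤ n) : (spectrum ℂ a).Finite := by
  have hfin : (algSpectrum A a).Finite := Set.finite_of_encard_le_coe h
  refine (hfin.insert 0).subset fun z hz => ?_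
  by_cases h0 : z = 0
  · exact Or.inl h0
  · exact Or.inr (mem_algSpectrum_of_mem_spectrum hab h0 hz)

end Algebra

theorem spectrum_real_finite {R : Type*} [Ring R] [Algebra ℂ R] {a : R}
    (h : (spectrum ℂ a).Finite) : (spectrum ℝ a).Finite := by
  have : spectrum ℝ a = (fun x : ℝ => (x : ℂ)) ⁻¹' spectrum ℂ a :=
    (spectrum.preimage_algebraMap (R := ℝ) ℂ (a := a)).symm
  rw [this]
  exact h.preimage Complex.ofReal_injective.injOn

/-! ### Orthogonal partitions of a projection -/

section Family

variable {R : Type*} [Ring R] [StarRing R]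

/-- A family of nonzero pairwise orthogonal projections with sum `p`. -/
structure IsProjectionPartition (p : R) {m : ℕ} (e : Fin m → R) : Prop where
  proj : ∀ i, IsStarProjection (e i)
  ne_zero : ∀ i, e i ≠ 0
  orthogonal : ∀ i j, i ≠ j → e i * e j = 0
  sum_eq : ∑ i, e i = p

namespace IsProjectionPartition

variable {p : R} {m : ℕ} {e : Fin m → R}

theorem mul_self (h : IsProjectionPartition p e) (i : Fin m) : e i * e i = e i :=
  (h.proj i).isIdempotentElem

theorem mul_right_eq (h : IsProjectionPartition p e) (i : Fin m) : e i * p = e i := by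
  rw [← h.sum_eq, Finset.mul_sum, Finset.sum_eq_single i (fun j _ hj => h.orthogonal i j hj.symm)
    (by simp), h.mul_self]

theorem split (h : IsProjectionPartition p e) (i : Fin m) {q : R} (hq : IsStarProjection q)
    (hqe : q * e i = q) (hq0 : q ≠ 0) (hqi : q ≠ e i) :
    IsProjectionPartition p (Fin.cons (e i - q) (Function.update e i q) : Fin (m + 1) → R) := by
  have heq : e i * q = q := by
    have := congrArg star hqe
    rwa [star_mul, hq.isSelfAdjoint.star_eq, (h.proj i).isSelfAdjoint.star_eq] at this
  have hqq : q * q = q := hq.isIdempotentElem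
  have hl : ∀ j, j ≠ i → q * e j = 0 := fun j hj => by
    rw [← hqe, mul_assoc, h.orthogonal i j hj.symm, mul_zero]
  have hr : ∀ j, j ≠ i → e j * q = 0 := fun j hj => by
    rw [← heq, ← mul_assoc, h.orthogonal j i hj, zero_mul]
  refine ⟨?_, ?_, ?_, ?_⟩
  · refine Fin.cases ⟨?_, ?_⟩ fun j => ?_
    · change (e i - q) * (e i - q) = e i - q
      rw [sub_mul, mul_sub, mul_sub, h.mul_self, heq, hqe, hqq, sub_self, sub_zero]
    · exact (h.proj i).isSelfAdjoint.sub hq.isSelfAdjoint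
    · rw [Fin.cons_succ]
      by_cases hj : j = i
      · subst hj; rwa [Function.update_self]
      · rw [Function.update_of_ne hj]; exact h.proj j
  · refine Fin.cases ?_ fun j => ?_
    · exact sub_ne_zero.2 hqi.symm
    · rw [Fin.cons_succ]
      by_cases hj : j = i
      · subst hj; rwa [Function.update_self]
      · rw [Function.update_of_ne hj]; exact h.ne_zero j
  · refine Fin.cases (Fin.cases (fun h => absurd rfl h) fun k _ => ?_)
      fun j => Fin.cases (fun _ => ?_) fun k hjk => ?_
    · rw [Fin.cons_succ, Fin.cons_zero]
      by_cases hk : k = i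
      · subst hk; rw [Function.update_self, sub_mul, heq, hqq, sub_self]
      · rw [Function.update_of_ne hk, sub_mul, h.orthogonal i k (Ne.symm hk), hl k hk, sub_self]
    · rw [Fin.cons_succ, Fin.cons_zero]
      by_cases hk : j = i
      · subst hk; rw [Function.update_self, mul_sub, hqe, hqq, sub_self]
      · rw [Function.update_of_ne hk, mul_sub, h.orthogonal j i hk, hr j hk, sub_self]
    · have hjk' : j ≠ k := fun h => hjk (congrArg _ h)
      rw [Fin.cons_succ, Fin.cons_succ]
      by_cases hj : j = i
      · subst hj
        rw [Function.update_self, Function.update_of_ne hjk'.symm, hl k hjk'.symm]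
      · rw [Function.update_of_ne hj]
        by_cases hk : k = i
        · subst hk; rw [Function.update_self, hr j hj]
        · rw [Function.update_of_ne hk, h.orthogonal j k hjk']
  · rw [Fin.sum_univ_succ, Fin.cons_zero]
    simp only [Fin.cons_succ]
    rw [Finset.sum_update_of_mem (Finset.mem_univ i), ← h.sum_eq,
      ← Finset.add_sum_erase _ _ (Finset.mem_univ i), Finset.sdiff_singleton_eq_erase]
    abel

theorem exists_partition {p : R} (hp : IsStarProjection p) :
    ∃ (m : ℕ) (e : Fin m → R), IsProjectionPartition p e := by
  by_cases h0 : p = 0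
  · exact ⟨0, Fin.elim0, ⟨fun i => i.elim0, fun i => i.elim0, fun i => i.elim0, by simp [h0]⟩⟩
  · exact ⟨1, fun _ => p, ⟨fun _ => hp, fun _ => h0,
      fun i j hij => absurd (Subsingleton.elim i j) hij, by simp⟩⟩

/-- If `S` were an `A`-inverse of `i - T`, multiplying by `e i * B` would give `e i = e i (i - T) S
= 0`. -/
theorem encard_ge [Algebra ℂ R] (h : IsProjectionPartition p e) {A B : R} (hBA : B * A = p) :
    (m : ℕ∞) ≤ (algSpectrum A (∑ i : Fin m, ((i : ℕ) : ℂ) • e i)).encard := by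
  have hsub : Set.range (fun i : Fin m => ((i : ℕ) : ℂ)) ⊆
      algSpectrum A (∑ i : Fin m, ((i : ℕ) : ℂ) • e i) := by
    rintro _ ⟨i, rfl⟩ ⟨S, hS, -⟩
    refine h.ne_zero i ?_
    have h1 := congrArg (e i * B * ·) hS
    simp only [← mul_assoc] at h1
    rw [mul_assoc (e i) B A, hBA, h.mul_right_eq, mul_sub, Finset.mul_sum,
      Finset.sum_eq_single i (fun j _ hj => by
        rw [mul_smul_comm, h.orthogonal i j hj.symm, smul_zero]) (by simp),
      mul_smul_comm, mul_one, mul_smul_comm, h.mul_self, sub_self, zero_mul] at h1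
    exact h1.symm
  have hinj : Function.Injective (fun i : Fin m => ((i : ℕ) : ℂ)) := fun i j hij =>
    Fin.ext (Nat.cast_injective hij)
  calc (m : ℕ∞) = (Set.univ : Set (Fin m)).encard := by simp
    _ = (Set.range (fun i : Fin m => ((i : ℕ) : ℂ))).encard := by
      rw [← Set.image_univ, hinj.encard_image]
    _ ≤ _ := Set.encard_le_encard hsub

end IsProjectionPartition

end Family

/-! ### Minimal projections and Peirce components -/

section Minimal

variable {R : Type*} [CStarAlgebra R]

/-- On a finite spectrum every function is continuous, so the spectral projection at a nonzero point
`l` exists in the algebra. -/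
theorem exists_mul_subprojection {e a : R} (ha : IsSelfAdjoint a)
    (hae : a * e = a) (hfin : (spectrum ℝ a).Finite) (hns : ∀ c : ℂ, a ≠ c • e) :
    ∃ q : R, IsStarProjection q ∧ q * e = q ∧ q ≠ 0 ∧ q ≠ e := by
  have hc : ∀ f : ℝ → ℝ, ContinuousOn f (spectrum ℝ a) := fun f => hfin.continuousOn f
  obtain ⟨l, hl, hl0⟩ : ∃ l ∈ spectrum ℝ a, l ≠ 0 := by
    by_contra! hcon
    refine hns 0 ?_
    rw [zero_smul, ← cfc_id ℝ a, ← cfc_zero ℝ a]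
    exact cfc_congr fun x hx => hcon x hx
  set g : ℝ → ℝ := fun x => if x = l then 1 else 0 with hg
  -- As `l ≠ 0`, the indicator of `l` is a multiple of the identity function, so the projection is a
  -- left multiple of `a` and absorbs `e`.
  have hq1 : cfc g a * e = cfc g a := by
    have : cfc (fun x => if x = l then l⁻¹ else 0) a * cfc (fun x : ℝ => x) a = cfc g a := by
      rw [← cfc_mul _ _ a (hc _) (hc _)]
      refine cfc_congr fun x _ => ?_
      by_cases hx : x = l <;> simp [hg, hx, hl0]
    rw [cfc_id' ℝ a] at this
    rw [← this, mul_assoc, hae]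
  refine ⟨cfc g a, ⟨?_, cfc_predicate g a⟩, hq1, fun h0 => ?_, fun he => ?_⟩
  · change cfc g a * cfc g a = cfc g a
    rw [← cfc_mul _ _ a (hc _) (hc _)]
    refine cfc_congr fun x _ => ?_
    by_cases hx : x = l <;> simp [hg, hx]
  · have hmem : (1 : ℝ) ∈ spectrum ℝ (cfc g a) := by
      rw [cfc_map_spectrum g a ha (hc _)]
      exact ⟨l, hl, by simp [hg]⟩
    rw [h0, spectrum.mem_iff, sub_zero, map_one] at hmem
    exact hmem isUnit_one
  · refine hns l ?_
    have h1 : a * cfc g a = l • cfc g a := by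
      nth_rw 1 [← cfc_id' ℝ a]
      rw [← cfc_mul _ _ a (hc _) (hc _), ← cfc_const_mul l g a (hc _)]
      refine cfc_congr fun x _ => ?_
      by_cases hx : x = l <;> simp [hg, hx]
    rw [he, hae] at h1
    rw [h1, Complex.coe_smul]

/-- In a projection whose corner has no proper subprojections, every element is a scalar. -/
theorem exists_eq_smul_of_no_subprojection {e : R} (he : IsStarProjection e)
    (hfin : ∀ a : R, IsSelfAdjoint a → a * e = a → (spectrum ℝ a).Finite)
    (hmin : ∀ q : R, IsStarProjection q → q * e = q → q ≠ 0 → q = e)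
    {x : R} (hx : x * e = x) (hx' : e * x = x) : ∃ c : ℂ, x = c • e := by
  have key : ∀ a : R, IsSelfAdjoint a → a * e = a → ∃ c : ℂ, a = c • e := by
    intro a ha hae
    by_contra! hns
    obtain ⟨q, hq, hqe, hq0, hqne⟩ := exists_mul_subprojection ha hae (hfin a ha hae) hns
    exact hqne (hmin q hq hqe hq0)
  have hsx : star x * e = star x := by
    have := congrArg star hx'
    rwa [star_mul, he.isSelfAdjoint.star_eq] at this
  obtain ⟨c, hc⟩ := key (realPart x : R) (realPart x).2 (by
    rw [realPart_apply_coe, smul_mul_assoc, add_mul, hx, hsx])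
  obtain ⟨d, hd⟩ := key (imaginaryPart x : R) (imaginaryPart x).2 (by
    rw [imaginaryPart_apply_coe, smul_mul_assoc, smul_mul_assoc, sub_mul, hx, hsx])
  refine ⟨c + Complex.I * d, ?_⟩
  rw [← realPart_add_I_smul_imaginaryPart x, hc, hd, smul_smul, add_smul]

/-- The Peirce component `e R f` of two minimal projections is at most one-dimensional. -/
theorem exists_spanning_of_minimal {e f : R} (he : IsStarProjection e) (hf : IsStarProjection f)
    (hme : ∀ x : R, x * e = x → e * x = x → ∃ c : ℂ, x = c • e)
    (hmf : ∀ x : R, x * f = x → f * x = x → ∃ c : ℂ, x = c • f) :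
    ∃ v : R, ∀ y : R, ∃ c : ℂ, e * y * f = c • v := by
  by_cases h0 : ∀ y : R, e * y * f = 0
  · exact ⟨0, fun y => ⟨0, by rw [h0, smul_zero]⟩⟩
  push Not at h0
  obtain ⟨z, hz⟩ := h0
  have hee : e * e = e := he.isIdempotentElem
  have hff : f * f = f := hf.isIdempotentElem
  set x := e * z * f with hx
  have hxf : x * f = x := by rw [hx, mul_assoc, hff]
  have hex : e * x = x := by rw [hx, ← mul_assoc, ← mul_assoc, hee]
  have hsx : star x * e = star x := by
    have := congrArg star hex
    rwa [star_mul, he.isSelfAdjoint.star_eq] at this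
  have hfx : f * star x = star x := by
    have := congrArg star hxf
    rwa [star_mul, hf.isSelfAdjoint.star_eq] at this
  obtain ⟨c, hc⟩ := hmf (star x * x) (by rw [mul_assoc, hxf]) (by rw [← mul_assoc, hfx])
  have hc0 : c ≠ 0 := by
    rintro rfl
    rw [zero_smul, CStarRing.star_mul_self_eq_zero_iff] at hc
    exact hz hc
  refine ⟨x, fun y => ?_⟩
  obtain ⟨d, hd⟩ := hme (e * y * f * star x) (by rw [mul_assoc, hsx])
    (by rw [← mul_assoc, ← mul_assoc, ← mul_assoc, hee])
  refine ⟨c⁻¹ * d, ?_⟩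
  -- Evaluate `e y f x⋆ x` in two ways: `x⋆ x = c f` and `e y f x⋆ = d e`.
  have : c • (e * y * f) = d • x := by
    calc c • (e * y * f) = e * y * f * (c • f) := by rw [mul_smul_comm, mul_assoc _ f f, hff]
      _ = e * y * f * star x * x := by rw [← hc, ← mul_assoc]
      _ = d • x := by rw [hd, smul_mul_assoc, hex]
  rw [← smul_smul, ← this, smul_smul, inv_mul_cancel₀ hc0, one_smul]

theorem IsProjectionPartition.rank_le {p : R} {m : ℕ} {e : Fin m → R}
    (h : IsProjectionPartition p e)
    (hmin : ∀ i, ∀ x : R, x * e i = x → e i * x = x → ∃ c : ℂ, x = c • e i)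
    (V : Submodule ℂ R) (hV : ∀ x ∈ V, p * x * p = x) :
    Module.rank ℂ V ≤ (m : Cardinal) ^ 2 := by
  classical
  choose v hv using fun ij : Fin m × Fin m =>
    exists_spanning_of_minimal (h.proj ij.1) (h.proj ij.2) (hmin ij.1) (hmin ij.2)
  have hle : V ≤ Submodule.span ℂ (Finset.univ.image v : Set R) := by
    intro x hx
    rw [← hV x hx, ← h.sum_eq, Finset.sum_mul, Finset.sum_mul]
    refine Submodule.sum_mem _ fun i _ => ?_
    rw [Finset.mul_sum]
    refine Submodule.sum_mem _ fun j _ => ?_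
    obtain ⟨c, hc⟩ := hv (i, j) x
    rw [hc]
    exact Submodule.smul_mem _ _ (Submodule.subset_span (by simp))
  calc Module.rank ℂ V ≤ _ := Submodule.rank_mono hle
    _ ≤ ((Finset.univ.image v).card : Cardinal) := rank_span_finset_le _
    _ ≤ ((m ^ 2 : ℕ) : Cardinal) := by
      refine Nat.cast_le.2 (Finset.card_image_le.trans ?_)
      simp [sq]
    _ = _ := by push_cast; rfl

end Minimal

/-! ### Support projection and the dimension bound -/

section CStar

variable {R : Type*} [CStarAlgebra R] [PartialOrder R] [StarOrderedRing R]

/-- On the spectrum `x ^ 3 ≤ c ^ 2 * x`; this allows the hypothesis to be applied to `T = A`. -/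
theorem exists_cube_le {A : R} (hA : 0 ≤ A) : ∃ c : ℝ, star A * A * A ≤ c • A := by
  have hsa : IsSelfAdjoint A := IsSelfAdjoint.of_nonneg hA
  obtain ⟨c, hc⟩ := (spectrum.isCompact (𝕜 := ℝ) A).bddAbove
  refine ⟨c ^ 2, ?_⟩
  have h3 : star A * A * A = cfc (fun x : ℝ => x * x * x) A := by
    rw [cfc_mul _ _ A, cfc_mul _ _ A, cfc_id' ℝ A, hsa.star_eq]
  rw [h3, ← cfc_const_mul_id (R := ℝ) (c ^ 2) A]
  refine cfc_mono fun x hx => ?_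
  have hx0 : 0 ≤ x := spectrum_nonneg_of_nonneg hA hx
  have hxc : x ≤ c := hc hx
  have : x * x ≤ c ^ 2 := by nlinarith
  exact mul_le_mul_of_nonneg_right this hx0

/-- A positive element with finite spectrum has a support projection, dominated by a multiple
of it, and an inverse relative to that projection. -/
theorem exists_support_projection {A : R} (hA : 0 ≤ A) (hfin : (spectrum ℝ A).Finite) :
    ∃ p B : R, IsStarProjection p ∧ p * A = A ∧ A * p = A ∧ B * A = p ∧
      ∃ c : ℝ, p ≤ c • A := by
  have hsa : IsSelfAdjoint A := IsSelfAdjoint.of_nonneg hA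
  have hc : ∀ f : ℝ → ℝ, ContinuousOn f (spectrum ℝ A) := fun f => hfin.continuousOn f
  set g : ℝ → ℝ := fun x => if x = 0 then 0 else 1 with hg
  -- The convention `0⁻¹ = 0` makes `x⁻¹ * x` the indicator of the nonzero spectrum.
  refine ⟨cfc g A, cfc (fun x : ℝ => x⁻¹) A, ⟨?_, cfc_predicate g A⟩, ?_, ?_, ?_, ?_⟩
  · change cfc g A * cfc g A = cfc g A
    rw [← cfc_mul _ _ A (hc _) (hc _)]
    refine cfc_congr fun x _ => ?_
    by_cases hx : x = 0 <;> simp [hg, hx]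
  · have : cfc g A * cfc (fun x : ℝ => x) A = cfc (fun x : ℝ => x) A := by
      rw [← cfc_mul _ _ A (hc _) (hc _)]
      refine cfc_congr fun x _ => ?_
      by_cases hx : x = 0 <;> simp [hg, hx]
    rwa [cfc_id' ℝ A] at this
  · have : cfc (fun x : ℝ => x) A * cfc g A = cfc (fun x : ℝ => x) A := by
      rw [← cfc_mul _ _ A (hc _) (hc _)]
      refine cfc_congr fun x _ => ?_
      by_cases hx : x = 0 <;> simp [hg, hx]
    rwa [cfc_id' ℝ A] at this
  · have : cfc (fun x : ℝ => x⁻¹) A * cfc (fun x : ℝ => x) A = cfc g A := by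
      rw [← cfc_mul _ _ A (hc _) (hc _)]
      refine cfc_congr fun x _ => ?_
      by_cases hx : x = 0 <;> simp [hg, hx]
    rwa [cfc_id' ℝ A] at this
  · obtain ⟨c, hcb⟩ := (hfin.image fun x => x⁻¹).bddAbove
    refine ⟨max c 0, ?_⟩
    rw [← cfc_const_mul_id (R := ℝ) (max c 0) A]
    refine cfc_mono (fun x hx => ?_) (hc _) (hc _)
    by_cases h0 : x = 0
    · simp [hg, h0]
    · have hx0 : 0 < x := lt_of_le_of_ne (spectrum_nonneg_of_nonneg hA hx) (Ne.symm h0)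
      have h1 : x⁻¹ ≤ max c 0 := (hcb ⟨x, hx, rfl⟩).trans (le_max_left _ _)
      simp only [hg, h0, if_false]
      calc (1 : ℝ) = x⁻¹ * x := (inv_mul_cancel₀ h0).symm
        _ ≤ max c 0 * x := mul_le_mul_of_nonneg_right h1 hx0.le

/-- `T⋆ A T = p (T⋆ A T) p ≤ ‖T⋆ A T‖ p`, and `p ≤ c • A`. -/
theorem exists_conj_le {A p : R} (hA : 0 ≤ A) (hp : IsStarProjection p) {c : ℝ}
    (hpA : p ≤ c • A) {T : R} (hT : T * p = T) : ∃ d : ℝ, star T * A * T ≤ d • A := by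
  have hsa : IsSelfAdjoint (star T * A * T) :=
    IsSelfAdjoint.of_nonneg (star_left_conjugate_nonneg hA T)
  refine ⟨‖star T * A * T‖ * c, ?_⟩
  have h1 := star_left_conjugate_le_conjugate hsa.le_algebraMap_norm_self p
  have h2 : star p * (star T * A * T) * p = star T * A * T := by
    rw [mul_assoc, mul_assoc (star T * A), hT, mul_assoc (star T), ← mul_assoc (star p),
      ← star_mul, hT]
  have h3 : star p * algebraMap ℝ R ‖star T * A * T‖ * p = ‖star T * A * T‖ • p := by
    rw [Algebra.algebraMap_eq_smul_one, mul_smul_comm, mul_one, smul_mul_assoc,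
      hp.isSelfAdjoint.star_eq, hp.isIdempotentElem.eq]
  rw [h2, h3] at h1
  rw [← smul_smul]
  exact h1.trans (smul_le_smul_of_nonneg_left hpA (norm_nonneg _))

/-- If all elements `T` with `T⋆ A T ≤ c A` for some `c` have at most `n` points in their algebraic
`A`-spectrum, then `A R A` has dimension at most `n ^ 2`. -/
theorem rank_mulLeftRight_le {A : R} (hA : 0 ≤ A) (n : ℕ)
    (h : ∀ T : R, (∃ c : ℝ, star T * A * T ≤ c • A) → (algSpectrum A T).encard ≤ n) :
    Module.rank ℂ (LinearMap.range (LinearMap.mulLeftRight ℂ (A, A))) ≤ (n : Cardinal) ^ 2 := by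
  have hAfin : (spectrum ℝ A).Finite := spectrum_real_finite <|
    spectrum_finite_of_algSpectrum_encard_le (one_mul A).symm (h A (exists_cube_le hA))
  obtain ⟨p, B, hp, hpA, hAp, hBA, c, hple⟩ := exists_support_projection hA hAfin
  have hbdd : ∀ T : R, T * p = T → (algSpectrum A T).encard ≤ n := fun T hT =>
    h T (exists_conj_le hA hp hple hT)
  have hfin : ∀ a : R, a * p = a → (spectrum ℝ a).Finite := fun a ha =>
    spectrum_real_finite <| spectrum_finite_of_algSpectrum_encard_le (A := A) (b := a * B)
      (by rw [mul_assoc, hBA, ha]) (hbdd a ha)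
  have hle : ∀ m, (∃ e : Fin m → R, IsProjectionPartition p e) → m ≤ n := by
    rintro m ⟨e, he⟩
    refine Nat.cast_le.1 ((he.encard_ge hBA).trans (hbdd _ ?_))
    rw [Finset.sum_mul]
    exact Finset.sum_congr rfl fun i _ => by rw [smul_mul_assoc, he.mul_right_eq]
  set P : ℕ → Prop := fun m => ∃ e : Fin m → R, IsProjectionPartition p e
  -- Some partition exists and lengths are at most `n`, so refinement must stop.
  obtain ⟨m, ⟨e, he⟩, hmax⟩ : ∃ m, P m ∧ ¬ P (m + 1) := by
    by_contra! hcon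
    obtain ⟨m₀, hm₀⟩ := IsProjectionPartition.exists_partition hp
    have hall : ∀ k, P (m₀ + k) := fun k => by
      induction k with
      | zero => exact hm₀
      | succ k ih => exact hcon _ ih
    have := hle _ (hall (n + 1))
    omega
  refine (he.rank_le (fun i x hx hx' => ?_) _ ?_).trans ?_
  · refine exists_eq_smul_of_no_subprojection (he.proj i) (fun a _ hae => hfin a ?_) ?_ hx hx'
    · rw [← hae, mul_assoc, he.mul_right_eq]
    · intro q hq hqe hq0
      by_contra hne
      exact hmax ⟨_, he.split i hq hqe hq0 hne⟩
  · rintro _ ⟨x, rfl⟩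
    rw [LinearMap.mulLeftRight_apply]
    simp only [← mul_assoc, hpA]
    rw [mul_assoc _ A p, hAp]
  · have : m ≤ n := hle m ⟨e, he⟩
    exact_mod_cast Nat.pow_le_pow_left this 2

end CStar

/-! ### Transfer to von Neumann algebras -/

variable {H : Type*} [NormedAddCommGroup H] [InnerProductSpace ℂ H] [CompleteSpace H]

theorem isClosed_vonNeumannAlgebra (M : VonNeumannAlgebra H) :
    IsClosed (M.toStarSubalgebra : Set (H →L[ℂ] H)) := by
  rw [VonNeumannAlgebra.coe_toStarSubalgebra, ← M.centralizer_centralizer]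
  exact Set.isClosed_centralizer _

/-- A closed star subalgebra of bounded operators is a star-ordered ring for the Loewner order. -/
theorem starOrderedRing_of_isClosed (S : StarSubalgebra ℂ (H →L[ℂ] H))
    [IsClosed (S : Set (H →L[ℂ] H))] : StarOrderedRing S := by
  refine StarOrderedRing.of_nonneg_iff' (fun {x y} hxy z => ?_) fun x => ⟨fun hx => ?_, ?_⟩
  · exact add_le_add_right (α := H →L[ℂ] H) hxy z
  · have hpos : (x : H →L[ℂ] H).IsPositive :=
      (ContinuousLinearMap.nonneg_iff_isPositive (x : H →L[ℂ] H)).1 hx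
    have hsa : IsSelfAdjoint x := Subtype.ext hpos.isSelfAdjoint
    -- Spectral permanence: the spectrum in `S` is that in `H →L[ℂ] H`, so the square root can be
    -- taken inside `S`.
    have hres : SpectrumRestricts x ContinuousMap.realToNNReal := by
      rw [SpectrumRestricts.nnreal_iff]
      intro r hr
      refine SpectrumRestricts.nnreal_iff.1 hpos.spectrumRestricts r ?_
      rw [← spectrum.algebraMap_mem_iff ℂ] at hr ⊢
      exact S.mem_spectrum_iff.1 hr
    obtain ⟨s, hs, -, hss⟩ :=
      CFC.exists_sqrt_of_isSelfAdjoint_of_quasispectrumRestricts hsa hres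
    exact ⟨s, by rw [hs.star_eq, hss]⟩
  · rintro ⟨s, rfl⟩
    exact star_mul_self_nonneg (s : H →L[ℂ] H)

theorem algSpectrum_subset_aSpectrum (M : VonNeumannAlgebra H) (A T : M.toStarSubalgebra) :
    algSpectrum A T ⊆ aSpectrum M A T := fun _ hz ⟨S, _, hS⟩ => hz ⟨S, hS⟩

/-- A normalized positive functional gives `f (T⋆ A T) ≤ c * f A = c`. -/
theorem mem_aBounded_of_isPositive_sub (M : VonNeumannAlgebra H) {A T : M.toStarSubalgebra} {c : ℝ}
    (h : ((c • A - star T * A * T : M.toStarSubalgebra) : H →L[ℂ] H).IsPositive) :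
    T ∈ aBounded M A := by
  refine lt_of_le_of_lt (iSup₂_le fun f hf => ?_) (ENNReal.ofReal_lt_top (r := Real.sqrt c))
  refine ENNReal.ofReal_le_ofReal (Real.sqrt_le_sqrt ?_)
  have h1 := (Complex.le_def.1 (hf.1 _ h)).1
  rw [map_sub, ← Complex.coe_smul, map_smul, hf.2] at h1
  simpa using h1

end ASpectrum

theorem theorem3p2 {H : Type*} [NormedAddCommGroup H] [InnerProductSpace ℂ H] [CompleteSpace H]
    (M : VonNeumannAlgebra H) (A : M.toStarSubalgebra) (hA : (A : H →L[ℂ] H).IsPositive)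
    (n : ℕ)
    (h : ∀ T ∈ ASpectrum.aBounded M A, (ASpectrum.aSpectrum M A T).encard ≤ n) :
    Module.rank ℂ (ASpectrum.corner M A) ≤ (n : Cardinal) ^ 2 := by
  have : IsClosed (M.toStarSubalgebra : Set (H →L[ℂ] H)) := ASpectrum.isClosed_vonNeumannAlgebra M
  have : StarOrderedRing M.toStarSubalgebra := ASpectrum.starOrderedRing_of_isClosed M.toStarSubalgebra
  have hA0 : 0 ≤ A := (ContinuousLinearMap.nonneg_iff_isPositive (A : H →L[ℂ] H)).2 hA
  refine ASpectrum.rank_mulLeftRight_le hA0 n fun T ⟨c, hc⟩ => ?_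
  refine (Set.encard_le_encard (ASpectrum.algSpectrum_subset_aSpectrum M A T)).trans
    (h T (ASpectrum.mem_aBounded_of_isPositive_sub M (c := c) ?_))
  exact (ContinuousLinearMap.nonneg_iff_isPositive _).1 (sub_nonneg.2 hc)
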